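/- Let $G$ be a bipartite graph on a vertex set $V$ with $n \geq 5$ vertices, and let $w(G)$ be the whiskered graph of $G$: it has the $2n$ vertices $V \cup \{w_v : v \in V\}$ and the edges of $G$ together with the edges $\{v, w_v\}$ for $v \in V$. Let $\mathbb{K}$ be a field of characteristic zero and $S$ the polynomial ring over $\mathbb{K}$ in $2n$ variables indexed by the vertices of $w(G)$; for a set $\tau$ of vertices put $x_\tau = \prod_{i \in \tau} x_i$. Let $\mathcal{F}(w(G)) = (x_e : e \text{ an edge of } w(G)) \subset S$, let $$\mathcal{F}(w(G)) = \bigcap_{j=1}^{s} (x_i : i \in C_j)$$ be its primary decomposition (the irredundant intersection of its minimal primes), and let $J(w(G)) = (x_{C_1}, \dots, x_{C_s})$ be the cover ideal of $w(G)$. Let $\Delta$ be the facet complex of $J(w(G))$, that is, the simplicial complex $\Delta = \langle C_1, \dots, C_s \rangle$, whose facets are the supports of the minimal monomial generators of $J(w(G))$. Put $$A(\Delta) = \frac{S}{(x_\tau : \tau \notin \Delta) + (x_i^2 : i \in V(w(G)))}.$$ Then $A(\Delta)$ is a level monomial algebra: it is an artinian quotient of $S$ by a monomial ideal, and its socle $\{f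 : f A_1 = 0\}$ equals $A_d$, where $d = \max\{i : A_i \neq 0\}$. Moreover $A(\Delta)$ fails the strong Lefschetz property: there is no linear form $L \in A(\Delta)_1$ such that all multiplication maps $\times L^j : A(\Delta)_i \to A(\Delta)_{i+j}$, $i, j \geq 0$, have full rank (are injective or surjective). In particular, they do not all have full rank for a general linear form. -/

import Mathlib

/-!
Simplicial complexes, facet ideals, cover ideals, whiskered graphs and the Lefschetz properties of
graded quotients of polynomial rings.
-/

noncomputable section

open MvPolynomial

namespace Lefschetz

/-! ### Simplicial complexes -/

/-- A simplicial complex on (a subset of) the vertex set `V`: a collection of finite subsets of `V`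
that is closed under taking subsets. The empty set counts as a face. -/
abbrev SimplicialCpx (V : Type*) := LowerSet (Finset V)

/-- The facets are the inclusion-maximal faces. -/
def SimplicialCpx.facets {V : Type*} (Δ : SimplicialCpx V) : Set (Finset V) :=
  {F | Maximal (· ∈ Δ) F}

/-- The complex `⟨F₁, …, Fₛ⟩`, whose faces are the subsets of the sets `Fᵢ`. -/
def SimplicialCpx.generatedBy {V : Type*} (𝓕 : Set (Finset V)) : SimplicialCpx V :=
  lowerClosure 𝓕

/-! ### Squarefree monomial ideals of simplicial complexes -/

/-- The squarefree monomial `x_τ = ∏_{j ∈ τ} x_j`. -/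
def sqfreeMonomial (K : Type*) [Field K] {V : Type*} (τ : Finset V) : MvPolynomial V K :=
  ∏ j ∈ τ, X j

/-- The facet ideal `𝓕(Δ) = (x_F : F a facet of Δ)`. -/
def facetIdeal (K : Type*) [Field K] {V : Type*} (Δ : SimplicialCpx V) :
    Ideal (MvPolynomial V K) :=
  Ideal.span (sqfreeMonomial K '' Δ.facets)

/-- The Stanley–Reisner ideal `𝓝(Δ) = (x_τ : τ ∉ Δ)`. -/
def stanleyReisnerIdeal (K : Type*) [Field K] {V : Type*} (Δ : SimplicialCpx V) :
    Ideal (MvPolynomial V K) :=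
  Ideal.span (sqfreeMonomial K '' {τ | τ ∉ Δ})

/-- The facet complex of a squarefree monomial ideal `I`, that is, the simplicial complex `Δ` with
`𝓕(Δ) = I` (see `facetIdeal_eq_iff`): the complex generated by the supports of the minimal monomial
generators of `I`. -/
def facetComplex {K : Type*} [Field K] {V : Type*} (I : Ideal (MvPolynomial V K)) :
    SimplicialCpx V :=
  SimplicialCpx.generatedBy {F | Minimal (fun τ => sqfreeMonomial K τ ∈ I) F}

/-- The cover ideal `J(Δ)`. Writing the facet ideal as the irredundant intersection of its minimal
primes `(x_i : i ∈ C₁) ∩ ⋯ ∩ (x_i : i ∈ Cₛ)`, which is its primary decomposition,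
`J(Δ) = (x_{C₁}, …, x_{Cₛ})`. -/
def coverIdeal (K : Type*) [Field K] {V : Type*} (Δ : SimplicialCpx V) :
    Ideal (MvPolynomial V K) :=
  Ideal.span (sqfreeMonomial K ''
    {C : Finset V | Ideal.span (X '' (C : Set V)) ∈ (facetIdeal K Δ).minimalPrimes})

/-- The ideal `(𝓝(Δ), x_i² : i ∈ V)`, which defines the artinian algebra `A(Δ)`. -/
def definingIdeal (K : Type*) [Field K] {V : Type*} (Δ : SimplicialCpx V) :
    Ideal (MvPolynomial V K) :=
  stanleyReisnerIdeal K Δ ⊔ Ideal.span (Set.range fun i : V => (X i : MvPolynomial V K) ^ 2)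

/-! ### Graphs -/

/-- The complex `⟨e₁, …, e_r⟩` generated by the edges of a graph. -/
def graphComplex {V : Type*} (G : SimpleGraph V) : SimplicialCpx V :=
  SimplicialCpx.generatedBy {e | ∃ u v, G.Adj u v ∧ (e : Set V) = {u, v}}

/-- The whiskered graph `w(G)`: the original vertices are `Sum.inl v`, and for every vertex `v` there
is one new vertex `Sum.inr v`, which is adjacent to `Sum.inl v` only. -/
def whisker {V : Type*} (G : SimpleGraph V) : SimpleGraph (V ⊕ V) where
  Adj
    | Sum.inl u, Sum.inl v => G.Adj u v
    | Sum.inl u, Sum.inr v => u = v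
    | Sum.inr u, Sum.inl v => u = v
    | Sum.inr _, Sum.inr _ => False
  symm := ⟨by
    rintro (u | u) (v | v) h
    · exact SimpleGraph.Adj.symm h
    · exact Eq.symm h
    · exact Eq.symm h
    · exact h⟩
  loopless := ⟨by
    rintro (u | u) h
    · exact G.loopless.irrefl u h
    · exact h⟩

/-! ### Graded quotients `A = S/I` of a polynomial ring -/

/-- The degree `i` component `A_i` of `A = S/I` (for a homogeneous ideal `I`). -/
def gradedPiece {K : Type*} [Field K] {V : Type*} (I : Ideal (MvPolynomial V K)) (i : ℕ) :
    Submodule K (MvPolynomial V K ⧸ I) :=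
  (homogeneousSubmodule V K i).map (Ideal.Quotient.mkₐ K I).toLinearMap

/-- The socle `soc(A) = {f : f A₁ = 0}`. -/
def socle {K : Type*} [Field K] {V : Type*} (I : Ideal (MvPolynomial V K)) :
    Set (MvPolynomial V K ⧸ I) :=
  {f | ∀ l ∈ gradedPiece I 1, f * l = 0}

/-- `A` is level if `soc(A) = A_d` for `d = max {i : A_i ≠ 0}`. -/
def IsLevel {K : Type*} [Field K] {V : Type*} (I : Ideal (MvPolynomial V K)) : Prop :=
  ∃ d : ℕ, IsGreatest {i | gradedPiece I i ≠ ⊥} d ∧ socle I = gradedPiece I d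

/-- `I` is a monomial ideal: it is generated by monomials. -/
def IsMonomialIdeal {K : Type*} [Field K] {V : Type*} (I : Ideal (MvPolynomial V K)) : Prop :=
  ∃ s : Set (V →₀ ℕ), I = Ideal.span ((fun m => monomial m (1 : K)) '' s)

/-- `S/I` is a level monomial algebra: `I` is a monomial ideal and `S/I` is artinian and level. -/
def IsLevelMonomialAlgebra {K : Type*} [Field K] {V : Type*} (I : Ideal (MvPolynomial V K)) :
    Prop :=
  IsMonomialIdeal I ∧ IsArtinianRing (MvPolynomial V K ⧸ I) ∧ IsLevel I

/-- Multiplication by `a`, as a map `A_i → A_j`, has full rank, that is, it is injective or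
surjective. (Used for `a ∈ A_{j - i}`, where `a A_i ⊆ A_j`.) -/
def MulHasFullRank {K : Type*} [Field K] {V : Type*} (I : Ideal (MvPolynomial V K))
    (a : MvPolynomial V K ⧸ I) (i j : ℕ) : Prop :=
  Set.InjOn (fun f => a * f) (gradedPiece I i : Set (MvPolynomial V K ⧸ I)) ∨
    Set.SurjOn (fun f => a * f) (gradedPiece I i : Set (MvPolynomial V K ⧸ I)) (gradedPiece I j)

/-- The strong Lefschetz property of `A = S/I`: there is a linear form `L` such that all maps
`×L^j : A_i → A_{i+j}` have full rank. The linear forms with this property form a Zariski open set,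
so that, `K` being infinite, one has it if and only if the general linear form has it. -/
def HasSLP {K : Type*} [Field K] {V : Type*} (I : Ideal (MvPolynomial V K)) : Prop :=
  ∃ L ∈ gradedPiece I 1, ∀ i j : ℕ, MulHasFullRank I (L ^ j) i (i + j)

/-! ### The facet complex is well defined -/

theorem sqfreeMonomial_eq {K : Type*} [Field K] {V : Type*} (τ : Finset V) :
    sqfreeMonomial K τ = monomial (∑ j ∈ τ, Finsupp.single j 1) (1 : K) := by
  rw [sqfreeMonomial, monomial_sum_one]
  rfl

theorem sqfreeMonomial_dvd {K : Type*} [Field K] {V : Type*} {σ τ : Finset V} (h : σ ⊆ τ) :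
    sqfreeMonomial K σ ∣ sqfreeMonomial K τ :=
  Finset.prod_dvd_prod_of_subset _ _ _ h

theorem sqfreeMonomial_mem_span {K : Type*} [Field K] {V : Type*} {𝓕 : Set (Finset V)}
    {τ : Finset V} :
    sqfreeMonomial K τ ∈ Ideal.span (sqfreeMonomial K '' 𝓕) ↔ ∃ F ∈ 𝓕, F ⊆ τ := by
  classical
  constructor
  · intro h
    have e : sqfreeMonomial K '' 𝓕 = (fun m => monomial m (1 : K)) ''
        ((fun F : Finset V => ∑ j ∈ F, Finsupp.single j 1) '' 𝓕) := by
      rw [Set.image_image]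
      exact Set.image_congr fun F _ => sqfreeMonomial_eq F
    rw [e, mem_ideal_span_monomial_image] at h
    obtain ⟨_, ⟨F, hF, rfl⟩, hle⟩ := h (∑ j ∈ τ, Finsupp.single j 1) (by
      rw [sqfreeMonomial_eq, support_monomial]; simp)
    refine ⟨F, hF, fun v hv => ?_⟩
    have := hle v
    simp only [Finsupp.coe_finsetSum, Finset.sum_apply, Finsupp.single_apply,
      Finset.sum_ite_eq', hv, if_true] at this
    by_contra hn
    simp [hn] at this
  · rintro ⟨F, hF, h⟩
    exact Ideal.mem_of_dvd _ (sqfreeMonomial_dvd h) (Ideal.subset_span ⟨F, hF, rfl⟩)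

/-- For a squarefree monomial ideal `I`, the facet complex is the unique simplicial complex whose
facet ideal is `I`. -/
theorem facetIdeal_eq_iff {K : Type*} [Field K] {V : Type*} [Finite V] (𝓕 : Set (Finset V))
    (Δ : SimplicialCpx V) :
    facetIdeal K Δ = Ideal.span (sqfreeMonomial K '' 𝓕) ↔
      Δ = facetComplex (Ideal.span (sqfreeMonomial K '' 𝓕)) := by
  have : Finite (Finset V) := inferInstance
  constructor
  · intro h
    rw [← h]
    have hmin : {F | Minimal (fun τ => sqfreeMonomial K τ ∈ facetIdeal K Δ) F} = Δ.facets := by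
      ext F
      simp only [Set.mem_ofPred_eq, facetIdeal, sqfreeMonomial_mem_span]
      constructor
      · rintro ⟨⟨F', hF', hs⟩, hm⟩
        have : F ⊆ F' := hm ⟨F', hF', subset_rfl⟩ hs
        exact (this.antisymm hs) ▸ hF'
      · intro hF
        refine ⟨⟨F, hF, subset_rfl⟩, ?_⟩
        rintro G ⟨F', hF', hs⟩ hGF
        have : F ⊆ F' := hF'.2 hF.1 (hs.trans hGF)
        exact this.trans hs
    rw [facetComplex, hmin]
    ext τ
    simp only [SimplicialCpx.generatedBy, SetLike.mem_coe, mem_lowerClosure]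
    constructor
    · intro hτ
      obtain ⟨F, hle, hF⟩ := (Set.toFinite (Δ : Set (Finset V))).exists_le_maximal hτ
      exact ⟨F, hF, hle⟩
    · rintro ⟨F, hF, hle⟩
      exact Δ.lower hle hF.1
  · rintro rfl
    set I := Ideal.span (sqfreeMonomial K '' 𝓕) with hI
    have hfac : (facetComplex I).facets = {F | Minimal (fun τ => sqfreeMonomial K τ ∈ I) F} := by
      ext F
      simp only [SimplicialCpx.facets, facetComplex, SimplicialCpx.generatedBy, Set.mem_ofPred_eq,
        mem_lowerClosure]
      constructor
      · rintro ⟨⟨G, hG, hle⟩, hm⟩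
        have : G ≤ F := hm ⟨G, hG, le_rfl⟩ hle
        exact (this.antisymm hle) ▸ hG
      · intro hF
        refine ⟨⟨F, hF, le_rfl⟩, ?_⟩
        rintro G ⟨G', hG', hle⟩ hFG
        exact hle.trans (hG'.2 hF.1 (hFG.trans hle))
    rw [facetIdeal, hfac]
    apply le_antisymm
    · rw [Ideal.span_le]
      rintro _ ⟨F, hF, rfl⟩
      exact hF.1
    · rw [hI, Ideal.span_le]
      rintro _ ⟨F, hF, rfl⟩
      rw [SetLike.mem_coe, sqfreeMonomial_mem_span]
      obtain ⟨G, hle, hG⟩ := (Set.toFinite {τ | sqfreeMonomial K τ ∈ I}).exists_le_minimal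
        (a := F) (Ideal.subset_span ⟨F, hF, rfl⟩)
      exact ⟨G, hG, hle⟩

end Lefschetz

end

open Lefschetz

namespace Lefschetz

open MvPolynomial

/-! The squarefree monomials of the faces of `Δ` form a basis of `A(Δ)`, so every question becomes
one about coefficients (`mem_definingIdeal_iff`). The facets are the minimal vertex covers of
`w(G)`. Each contains exactly one of `v` and `w_v`, so `Δ` is pure with facets of size `n`, and
purity makes `A(Δ)` level.

The strong Lefschetz property fails at `×L^(n-1) : A_1 → A_n`, for every linear form `L`.

Not injective: let `p_v` be the part of `L` in the variables of `v` and `w_v`. Since `{v, w_v}` is a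
nonface, `p_v² = 0` in `A`. Hence `L^(n-1) p_v = (n-1)! ∏ p_u` does not depend on `v`, and the
differences `p_u - p_v` lie in the kernel. If these all vanish then `L = 0`.

Not surjective: a bipartite graph on at least three vertices has nonadjacent `p ≠ q`. Choosing `p`
or `w_p`, and `q` or `w_q`, next to all other vertices of `G` gives four facets. Some nonzero
combination of `∂_p`, `∂_{w_p}` kills `L`, as does one of `∂_q`, `∂_{w_q}`. Their composite commutes
with multiplication by `L^m` and kills linear forms, so it yields a nonzero functional on `A_n` that
vanishes on the image of `A_1`. -/

/-! ### Monomial bases of the algebras `A(Δ)` -/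

/-- The exponent of the squarefree monomial `x_τ`. -/
noncomputable def sqfreeExponent {V : Type*} (τ : Finset V) : V →₀ ℕ := ∑ j ∈ τ, Finsupp.single j 1

theorem sqfreeExponent_apply {V : Type*} [DecidableEq V] (τ : Finset V) (i : V) :
    sqfreeExponent τ i = if i ∈ τ then 1 else 0 := by
  simp [sqfreeExponent, Finsupp.single_apply]

theorem sqfreeExponent_insert {V : Type*} [DecidableEq V] {τ : Finset V} {i : V} (h : i ∉ τ) :
    sqfreeExponent (insert i τ) = sqfreeExponent τ + Finsupp.single i 1 := by
  rw [sqfreeExponent, Finset.sum_insert h, add_comm, sqfreeExponent]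

theorem degree_sqfreeExponent {V : Type*} (τ : Finset V) :
    (sqfreeExponent τ).degree = τ.card := by
  simp [sqfreeExponent]

theorem sqfreeExponent_le_iff {V : Type*} {σ τ : Finset V} :
    sqfreeExponent σ ≤ sqfreeExponent τ ↔ σ ⊆ τ := by
  classical
  constructor
  · intro h i hi
    have := h i
    rw [sqfreeExponent_apply, sqfreeExponent_apply, if_pos hi] at this
    by_contra hn
    simp [hn] at this
  · intro h i
    rw [sqfreeExponent_apply, sqfreeExponent_apply]
    by_cases hi : i ∈ σ
    · simp [hi, h hi]
    · simp [hi]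

theorem sqfreeExponent_injective {V : Type*} :
    Function.Injective (sqfreeExponent : Finset V → V →₀ ℕ) := fun _ _ h =>
  (sqfreeExponent_le_iff.1 h.le).antisymm (sqfreeExponent_le_iff.1 h.ge)

theorem eq_sqfreeExponent_support {V : Type*} {m : V →₀ ℕ} (h : ∀ i, m i < 2) :
    m = sqfreeExponent m.support := by
  classical
  ext i
  rw [sqfreeExponent_apply]
  have := h i
  split_ifs with hi <;> rw [Finsupp.mem_support_iff] at hi <;> omega

theorem definingIdeal_eq_span (K : Type*) [Field K] {V : Type*} (Δ : SimplicialCpx V) :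
    definingIdeal K Δ = Ideal.span ((fun m => monomial m (1 : K)) ''
      (sqfreeExponent '' {τ | τ ∉ Δ} ∪ Set.range fun i : V => Finsupp.single i 2)) := by
  rw [definingIdeal, stanleyReisnerIdeal, ← Ideal.span_union, Set.image_union, Set.image_image,
    ← Set.range_comp]
  congr 3
  · exact funext fun τ => sqfreeMonomial_eq τ
  · ext i : 1
    simp [X_pow_eq_monomial]

/-- A monomial ideal is tested monomial by monomial, and the monomials outside this one are exactly
the `x_τ` with `τ` a face. -/
theorem mem_definingIdeal_iff {K : Type*} [Field K] {V : Type*} {Δ : SimplicialCpx V}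
    {f : MvPolynomial V K} :
    f ∈ definingIdeal K Δ ↔ ∀ τ ∈ Δ, coeff (sqfreeExponent τ) f = 0 := by
  classical
  rw [definingIdeal_eq_span, mem_ideal_span_monomial_image]
  constructor
  · intro h τ hτ
    by_contra hc
    obtain ⟨_, ⟨σ, hσ, rfl⟩ | ⟨i, rfl⟩, hle⟩ := h _ (mem_support_iff.2 hc)
    · exact hσ (Δ.lower (sqfreeExponent_le_iff.1 hle) hτ)
    · have := hle i
      rw [sqfreeExponent_apply, Finsupp.single_eq_same] at this
      split_ifs at this <;> omega
  · intro h m hm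
    by_cases hi : ∃ i, 2 ≤ m i
    · obtain ⟨i, hi⟩ := hi
      exact ⟨_, Or.inr ⟨i, rfl⟩, by simpa using hi⟩
    · push Not at hi
      have e := eq_sqfreeExponent_support hi
      refine ⟨m, Or.inl ⟨m.support, fun hΔ => ?_, e.symm⟩, le_rfl⟩
      exact mem_support_iff.1 hm (e ▸ h _ hΔ)

theorem isMonomialIdeal_definingIdeal (K : Type*) [Field K] {V : Type*} (Δ : SimplicialCpx V) :
    IsMonomialIdeal (definingIdeal K Δ) :=
  ⟨_, definingIdeal_eq_span K Δ⟩

theorem X_sq_mem_definingIdeal (K : Type*) [Field K] {V : Type*} (Δ : SimplicialCpx V) (i : V) :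
    (X i : MvPolynomial V K) ^ 2 ∈ definingIdeal K Δ :=
  Ideal.mem_sup_right (Ideal.subset_span ⟨i, rfl⟩)

theorem sqfreeMonomial_mem_definingIdeal (K : Type*) [Field K] {V : Type*} {Δ : SimplicialCpx V}
    {τ : Finset V} (h : τ ∉ Δ) : sqfreeMonomial K τ ∈ definingIdeal K Δ :=
  Ideal.mem_sup_left (Ideal.subset_span ⟨τ, h, rfl⟩)

theorem isArtinianRing_quotient_definingIdeal (K : Type*) [Field K] {V : Type*} [Finite V]
    (Δ : SimplicialCpx V) : IsArtinianRing (MvPolynomial V K ⧸ definingIdeal K Δ) := by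
  have hint : ∀ i, IsIntegral K (Ideal.Quotient.mkₐ K (definingIdeal K Δ) (X i)) := fun i => by
    refine IsIntegral.of_pow two_pos ?_
    rw [← map_pow, Ideal.Quotient.mkₐ_eq_mk,
      Ideal.Quotient.eq_zero_iff_mem.2 (X_sq_mem_definingIdeal K Δ i)]
    exact isIntegral_zero
  have : Algebra.IsIntegral K (MvPolynomial V K ⧸ definingIdeal K Δ) := by
    refine ⟨fun a => ?_⟩
    obtain ⟨p, rfl⟩ := Ideal.Quotient.mkₐ_surjective K _ a
    induction p using MvPolynomial.induction_on with
    | C r => exact isIntegral_algebraMap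
    | add p q hp hq => rw [map_add]; exact hp.add hq
    | mul_X p i hp => rw [map_mul]; exact hp.mul (hint i)
  have : Module.Finite K (MvPolynomial V K ⧸ definingIdeal K Δ) := Algebra.IsIntegral.finite
  exact IsArtinianRing.of_finite K _

theorem gradedPiece_definingIdeal_ne_bot_iff {K : Type*} [Field K] {V : Type*}
    {Δ : SimplicialCpx V} {i : ℕ} :
    gradedPiece (definingIdeal K Δ) i ≠ ⊥ ↔ ∃ τ ∈ Δ, τ.card = i := by
  classical
  rw [Submodule.ne_bot_iff]
  constructor
  · rintro ⟨_, ⟨p, hp, rfl⟩, hne⟩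
    have hne : p ∉ definingIdeal K Δ := fun h => hne (Ideal.Quotient.eq_zero_iff_mem.2 h)
    rw [mem_definingIdeal_iff] at hne
    push Not at hne
    obtain ⟨τ, hτ, hc⟩ := hne
    refine ⟨τ, hτ, ?_⟩
    rw [← degree_sqfreeExponent]
    by_contra h
    exact hc (IsHomogeneous.coeff_eq_zero hp h)
  · rintro ⟨τ, hτ, rfl⟩
    refine ⟨_, ⟨monomial (sqfreeExponent τ) 1,
      isHomogeneous_monomial _ (degree_sqfreeExponent τ), rfl⟩, fun h => ?_⟩
    have := mem_definingIdeal_iff.1 (Ideal.Quotient.eq_zero_iff_mem.1 h) τ hτ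
    rw [coeff_monomial, if_pos rfl] at this
    exact one_ne_zero this

/-- The algebra `A(Δ)` of a pure simplicial complex is level. -/
theorem isLevel_definingIdeal_of_pure {K : Type*} [Field K] {V : Type*} {Δ : SimplicialCpx V}
    {d : ℕ} (hne : (⊥ : Finset V) ∈ Δ) (hpure : ∀ τ ∈ Δ, ∃ F ∈ Δ, τ ⊆ F ∧ F.card = d) :
    IsLevel (definingIdeal K Δ) := by
  classical
  have hle : ∀ τ ∈ Δ, τ.card ≤ d := fun τ hτ => by
    obtain ⟨F, -, hs, rfl⟩ := hpure τ hτ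
    exact Finset.card_le_card hs
  refine ⟨d, ⟨?_, ?_⟩, ?_⟩
  · obtain ⟨F, hF, -, hc⟩ := hpure _ hne
    exact gradedPiece_definingIdeal_ne_bot_iff.2 ⟨F, hF, hc⟩
  · intro i hi
    obtain ⟨τ, hτ, rfl⟩ := gradedPiece_definingIdeal_ne_bot_iff.1 hi
    exact hle τ hτ
  · ext f
    constructor
    · intro hf
      obtain ⟨p, rfl⟩ := Ideal.Quotient.mkₐ_surjective K _ f
      refine ⟨homogeneousComponent d p, homogeneousComponent_mem d p, ?_⟩
      refine Ideal.Quotient.eq.2 (mem_definingIdeal_iff.2 fun τ hτ => ?_)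
      rw [coeff_sub, coeff_homogeneousComponent, degree_sqfreeExponent]
      split_ifs with hd
      · exact sub_self _
      · obtain ⟨F, hF, hs, hc⟩ := hpure τ hτ
        -- A face that is not a facet extends by some vertex `i`; the coefficient of `p` at `τ` is
        -- that of `p * X i` at `insert i τ`, which vanishes for a socle element.
        obtain ⟨i, hiF, hi⟩ : ∃ i ∈ F, i ∉ τ := by
          by_contra! h
          exact hd (by rw [← hc, hs.antisymm h])
        have h0 := hf _ ⟨X i, isHomogeneous_X K i, rfl⟩
        have h1 : p * X i ∈ definingIdeal K Δ := Ideal.Quotient.eq_zero_iff_mem.1 h0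
        have h2 := mem_definingIdeal_iff.1 h1 (insert i τ)
          (Δ.lower (Finset.insert_subset hiF hs) hF)
        rw [sqfreeExponent_insert hi, coeff_mul_X] at h2
        rw [h2, sub_zero]
    · rintro ⟨p, hp, rfl⟩ _ ⟨q, hq, rfl⟩
      refine Ideal.Quotient.eq_zero_iff_mem.2 (mem_definingIdeal_iff.2 fun τ hτ => ?_)
      refine (IsHomogeneous.mul hp hq).coeff_eq_zero ?_
      have := hle τ hτ
      rw [degree_sqfreeExponent]
      omega

/-! ### Minimal primes of edge ideals -/

theorem X_mem_span_X_image_iff {K : Type*} [Field K] {V : Type*} {C : Set V} {i : V} :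
    (X i : MvPolynomial V K) ∈ Ideal.span (X '' C) ↔ i ∈ C := by
  classical
  rw [mem_ideal_span_X_image]
  simp [support_X, Finsupp.single_apply]

/-- The ideal is the kernel of the substitution `X i ↦ 0` for `i ∈ C`, an endomorphism of a domain.
-/
theorem isPrime_span_X_image (K : Type*) [Field K] {V : Type*} (C : Set V) :
    (Ideal.span (X '' C) : Ideal (MvPolynomial V K)).IsPrime := by
  classical
  let φ : MvPolynomial V K →ₐ[K] MvPolynomial V K := aeval fun i => if i ∈ C then 0 else X i
  have hφ : ∀ i, φ (X i) = if i ∈ C then 0 else X i := fun i => aeval_X _ _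
  have hcomp : (Ideal.Quotient.mkₐ K (Ideal.span (X '' C))).comp φ =
      Ideal.Quotient.mkₐ K (Ideal.span (X '' C)) := by
    refine MvPolynomial.algHom_ext fun i => ?_
    rw [AlgHom.comp_apply, hφ]
    split_ifs with hi
    · rw [map_zero]
      exact (Ideal.Quotient.eq_zero_iff_mem.2 (X_mem_span_X_image_iff.2 hi)).symm
    · rfl
  have hker : Ideal.span (X '' C) = RingHom.ker φ := by
    apply le_antisymm
    · rw [Ideal.span_le]
      rintro _ ⟨i, hi, rfl⟩
      rw [SetLike.mem_coe, RingHom.mem_ker, hφ, if_pos hi]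
    · intro f hf
      have := DFunLike.congr_fun hcomp f
      rw [AlgHom.comp_apply, RingHom.mem_ker.1 hf, map_zero] at this
      exact Ideal.Quotient.eq_zero_iff_mem.1 this.symm
  rw [hker]
  exact RingHom.ker_isPrime _

/-- `C` is a vertex cover of `G`. -/
def Covers {V : Type*} (G : SimpleGraph V) (C : Set V) : Prop :=
  ∀ u v, G.Adj u v → u ∈ C ∨ v ∈ C

theorem facetIdeal_graphComplex (K : Type*) [Field K] {V : Type*} (G : SimpleGraph V) :
    facetIdeal K (graphComplex G) = Ideal.span {p | ∃ u v, G.Adj u v ∧ p = X u * X v} := by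
  classical
  rw [facetIdeal]
  congr 1
  have hpair : ∀ (e : Finset V) (u v : V), (e : Set V) = {u, v} ↔ e = {u, v} := fun e u v => by
    rw [← Finset.coe_pair, Finset.coe_inj]
  ext p
  constructor
  · rintro ⟨F, ⟨⟨e, ⟨u, v, huv, he⟩, hFe⟩, hmax⟩, rfl⟩
    have : F = e := hFe.antisymm (hmax (subset_lowerClosure ⟨u, v, huv, he⟩) hFe)
    rw [hpair] at he
    exact ⟨u, v, huv, by rw [this, he, sqfreeMonomial, Finset.prod_pair huv.ne]⟩
  · rintro ⟨u, v, huv, rfl⟩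
    refine ⟨{u, v}, ⟨subset_lowerClosure ⟨u, v, huv, Finset.coe_pair⟩, ?_⟩,
      Finset.prod_pair huv.ne⟩
    rintro F ⟨e, ⟨u', v', huv', he⟩, hFe⟩ hle
    rw [hpair] at he
    refine (Finset.eq_of_subset_of_card_le hle ?_).ge
    rw [Finset.card_pair huv.ne, ← Finset.card_pair huv'.ne, ← he]
    exact Finset.card_le_card hFe

theorem facetIdeal_graphComplex_le_iff {K : Type*} [Field K] {V : Type*} {G : SimpleGraph V}
    {P : Ideal (MvPolynomial V K)} [hP : P.IsPrime] :
    facetIdeal K (graphComplex G) ≤ P ↔ Covers G {i | X i ∈ P} := by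
  rw [facetIdeal_graphComplex, Ideal.span_le]
  constructor
  · intro h u v huv
    exact hP.mem_or_mem (h ⟨u, v, huv, rfl⟩)
  · rintro h _ ⟨u, v, huv, rfl⟩
    rcases h u v huv with hu | hv
    · exact P.mul_mem_right _ hu
    · exact P.mul_mem_left _ hv

/-- The variables in any prime over the edge ideal form a vertex cover, so minimality among primes
reduces to minimality among covers. -/
theorem span_X_mem_minimalPrimes_iff {K : Type*} [Field K] {V : Type*} {G : SimpleGraph V}
    {C : Set V} :
    Ideal.span (X '' C) ∈ (facetIdeal K (graphComplex G)).minimalPrimes ↔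
      Minimal (Covers G) C := by
  have hset : ∀ D : Set V, {i | (X i : MvPolynomial V K) ∈ Ideal.span (X '' D)} = D :=
    fun D => Set.ext fun i => X_mem_span_X_image_iff
  have hcov : ∀ D : Set V, facetIdeal K (graphComplex G) ≤ Ideal.span (X '' D) ↔ Covers G D :=
    fun D => by
      have := isPrime_span_X_image K D
      rw [facetIdeal_graphComplex_le_iff, hset]
  constructor
  · rintro ⟨⟨-, hle⟩, hmin⟩
    refine ⟨(hcov C).1 hle, fun D hD hDC i hi => ?_⟩
    have := hmin ⟨isPrime_span_X_image K D, (hcov D).2 hD⟩ (Ideal.span_mono (Set.image_mono hDC))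
    exact X_mem_span_X_image_iff.1 (this (X_mem_span_X_image_iff.2 hi))
  · rintro ⟨hC, hmin⟩
    refine ⟨⟨isPrime_span_X_image K C, (hcov C).2 hC⟩, ?_⟩
    rintro P ⟨hP, hle⟩ hPC
    rw [Ideal.span_le]
    rintro _ ⟨i, hi, rfl⟩
    exact hmin (facetIdeal_graphComplex_le_iff.1 hle)
      (fun j hj => X_mem_span_X_image_iff.1 (hPC hj)) hi

/-- The facets of the facet complex of the cover ideal are the minimal vertex covers. -/
theorem mem_facetComplex_coverIdeal_iff {K : Type*} [Field K] {V : Type*} {G : SimpleGraph V}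
    {τ : Finset V} :
    τ ∈ facetComplex (coverIdeal K (graphComplex G)) ↔
      ∃ F : Finset V, Minimal (Covers G) (F : Set V) ∧ τ ⊆ F := by
  have key : ∀ F : Finset V,
      Minimal (fun σ => sqfreeMonomial K σ ∈ coverIdeal K (graphComplex G)) F ↔
        Minimal (Covers G) (F : Set V) := by
    intro F
    have hset : {C : Finset V | Ideal.span (X '' (C : Set V)) ∈
        (facetIdeal K (graphComplex G)).minimalPrimes} =
          {C : Finset V | Minimal (Covers G) (C : Set V)} :=
      Set.ext fun C => span_X_mem_minimalPrimes_iff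
    rw [coverIdeal, hset]
    simp only [sqfreeMonomial_mem_span, Set.mem_ofPred_eq]
    constructor
    · rintro ⟨⟨C, hC, hCF⟩, hmin⟩
      have : F = C := (hmin ⟨C, hC, subset_rfl⟩ hCF).antisymm hCF
      rwa [this]
    · intro hF
      refine ⟨⟨F, hF, subset_rfl⟩, ?_⟩
      rintro D ⟨C, hC, hCD⟩ hDF
      have : (F : Set V) ⊆ C := hF.2 hC.1 (Finset.coe_subset.2 (hCD.trans hDF))
      exact (Finset.coe_subset.1 this).trans hCD
  simp only [facetComplex, SimplicialCpx.generatedBy, mem_lowerClosure, Set.mem_ofPred_eq, key]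

/-! ### The complex of a whiskered graph -/

/-- The whisker at `v` forces one of its ends into the cover. If both are there, the new vertex can
be dropped, since its only neighbour is `v`. -/
theorem minimal_covers_whisker_iff {V : Type*} {G : SimpleGraph V} {C : Set (V ⊕ V)} :
    Minimal (Covers (whisker G)) C ↔
      (∀ v, Sum.inl v ∈ C ↔ Sum.inr v ∉ C) ∧ ∀ u v, G.Adj u v → Sum.inl u ∈ C ∨ Sum.inl v ∈ C := by
  constructor
  · rintro ⟨hC, hmin⟩
    refine ⟨fun v => ⟨fun hl hr => ?_, fun hr => ?_⟩, fun u v huv => hC _ _ huv⟩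
    · have hcov : Covers (whisker G) (C \ {Sum.inr v}) := by
        rintro (a | a) (b | b) hab
        · simpa using hC _ _ hab
        · obtain rfl : a = b := hab
          by_cases h : a = v
          · subst h; exact Or.inl (by simpa using hl)
          · simpa [h] using hC (Sum.inl a) (Sum.inr a) rfl
        · obtain rfl : a = b := hab
          by_cases h : a = v
          · subst h; exact Or.inr (by simpa using hl)
          · simpa [h] using hC (Sum.inr a) (Sum.inl a) rfl
        · exact hab.elim
      exact (hmin hcov Set.sdiff_subset hr).2 rfl
    · exact (hC (Sum.inl v) (Sum.inr v) rfl).resolve_right hr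
  · rintro ⟨hex, hcov⟩
    refine ⟨?_, ?_⟩
    · rintro (a | a) (b | b) hab
      · exact hcov a b hab
      · obtain rfl : a = b := hab
        rw [hex]; tauto
      · obtain rfl : a = b := hab
        rw [hex]; tauto
      · exact hab.elim
    · rintro D hD hDC (v | v) hv
      · exact (hD (Sum.inl v) (Sum.inr v) rfl).resolve_right fun h => (hex v).1 hv (hDC h)
      · exact (hD (Sum.inl v) (Sum.inr v) rfl).resolve_left fun h => (hex v).1 (hDC h) hv

theorem card_eq_of_minimal_covers_whisker {V : Type*} [Fintype V] {G : SimpleGraph V}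
    {F : Finset (V ⊕ V)} (hF : Minimal (Covers (whisker G)) (F : Set (V ⊕ V))) :
    F.card = Fintype.card V := by
  classical
  have hex := (minimal_covers_whisker_iff.1 hF).1
  have : F.card = ∑ z : V ⊕ V, if z ∈ F then 1 else 0 := by simp
  rw [this, Fintype.sum_sum_type, ← Finset.sum_add_distrib, Fintype.card_eq_sum_ones]
  refine Finset.sum_congr rfl fun v _ => ?_
  have := hex v
  simp only [Finset.mem_coe] at this
  by_cases h : Sum.inr v ∈ F <;> simp_all

/-- The faces of the facet complex of the cover ideal of `w(G)`: disjoint pairs of a set of vertices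
of `G` and an independent set of `G`. -/
theorem mem_facetComplex_whisker_iff {K : Type*} [Field K] {V : Type*} [Fintype V]
    {G : SimpleGraph V} {τ : Finset (V ⊕ V)} :
    τ ∈ facetComplex (coverIdeal K (graphComplex (whisker G))) ↔
      (∀ v, Sum.inl v ∈ τ → Sum.inr v ∉ τ) ∧
        ∀ u v, G.Adj u v → Sum.inr u ∈ τ → Sum.inr v ∉ τ := by
  classical
  simp only [mem_facetComplex_coverIdeal_iff, minimal_covers_whisker_iff, Finset.mem_coe]
  constructor
  · rintro ⟨F, ⟨hex, hcov⟩, hτF⟩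
    refine ⟨fun v hl hr => (hex v).1 (hτF hl) (hτF hr), fun u v huv hu hv => ?_⟩
    rcases hcov u v huv with h | h
    · exact (hex u).1 h (hτF hu)
    · exact (hex v).1 h (hτF hv)
  · rintro ⟨hdis, hind⟩
    -- The facet keeps the new vertices of `τ` and takes the original vertex at every other whisker.
    refine ⟨Finset.univ.filter (Sum.elim (fun v => Sum.inr v ∉ τ) (fun v => Sum.inr v ∈ τ)),
      ⟨fun v => by simp, fun u v huv => ?_⟩, ?_⟩
    · have := hind u v huv
      simp only [Finset.mem_filter, Finset.mem_univ, true_and, Sum.elim_inl]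
      tauto
    · rintro (v | v) hv
      · simpa using hdis v hv
      · simpa using hv

theorem isLevelMonomialAlgebra_whisker (K : Type*) [Field K] {V : Type*} [Fintype V]
    (G : SimpleGraph V) :
    IsLevelMonomialAlgebra
      (definingIdeal K (facetComplex (coverIdeal K (graphComplex (whisker G))))) := by
  refine ⟨isMonomialIdeal_definingIdeal K _, isArtinianRing_quotient_definingIdeal K _,
    isLevel_definingIdeal_of_pure (d := Fintype.card V) ?_ fun τ hτ => ?_⟩
  · rw [mem_facetComplex_whisker_iff]
    simp
  · obtain ⟨F, hF, hτF⟩ := mem_facetComplex_coverIdeal_iff.1 hτ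
    exact ⟨F, mem_facetComplex_coverIdeal_iff.2 ⟨F, hF, subset_rfl⟩, hτF,
      card_eq_of_minimal_covers_whisker hF⟩

/-! ### Failure of surjectivity -/

theorem pderiv_eq_C_of_isHomogeneous_one {K : Type*} [Field K] {V : Type*} {L : MvPolynomial V K}
    (hL : L.IsHomogeneous 1) (i : V) : pderiv i L = C (coeff (Finsupp.single i 1) L) := by
  classical
  ext m
  rw [coeff_pderiv, coeff_C]
  split_ifs with h
  · subst h; simp
  · rw [hL.coeff_eq_zero, zero_mul]
    rw [map_add, Finsupp.degree_single]
    intro h0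
    exact h ((Finsupp.degree_eq_zero_iff m).1 (by omega)).symm

/-- Derivations that kill `L` are linear over its powers, so `L ^ m` factors out. -/
theorem derivation_derivation_pow_mul_eq_zero {R A : Type*} [CommRing R] [CommRing A] [Algebra R A]
    (D E : Derivation R A A) {L z : A} (hD : D L = 0) (hE : E L = 0) (hz : D (E z) = 0) (m : ℕ) :
    D (E (L ^ m * z)) = 0 := by
  simp [Derivation.leibniz, Derivation.leibniz_pow, hD, hE, hz]

theorem coeff_pderiv_pderiv {K : Type*} [Field K] {V : Type*} [DecidableEq V] {ρ : Finset V}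
    {i j : V} (hij : i ≠ j) (hi : i ∉ ρ) (hj : j ∉ ρ) (g : MvPolynomial V K) :
    coeff (sqfreeExponent ρ) (pderiv i (pderiv j g)) =
      coeff (sqfreeExponent (insert i (insert j ρ))) g := by
  rw [Finset.insert_comm, sqfreeExponent_insert (by simp [hij.symm, hj]),
    sqfreeExponent_insert hi, coeff_pderiv, coeff_pderiv]
  simp [sqfreeExponent_apply, hi, hj, hij]

/-- The coefficient at `ρ` of the second-order derivative of `g` combines the coefficients of `g` at
the four faces. It vanishes on `L ^ m * q`, but equals `c * d ≠ 0` on the monomial of `insert i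
(insert j ρ)`. -/
theorem not_surjOn_pow_of_faces_aux {K : Type*} [Field K] {V : Type*} [DecidableEq V]
    {Δ : SimplicialCpx V} {ρ : Finset V} {i i' j j' : V} (hd : [i, i', j, j'].Nodup)
    (hρ : ∀ k ∈ [i, i', j, j'], k ∉ ρ)
    (hΔ : ∀ k ∈ [i, i'], ∀ l ∈ [j, j'], insert k (insert l ρ) ∈ Δ)
    {L : MvPolynomial V K} (hL : L.IsHomogeneous 1) {c c' d d' : K} (hc : c ≠ 0) (hd0 : d ≠ 0)
    (hcL : c * coeff (Finsupp.single i 1) L + c' * coeff (Finsupp.single i' 1) L = 0)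
    (hdL : d * coeff (Finsupp.single j 1) L + d' * coeff (Finsupp.single j' 1) L = 0) (m : ℕ) :
    ¬ Set.SurjOn (fun f => Ideal.Quotient.mk (definingIdeal K Δ) L ^ m * f)
      (gradedPiece (definingIdeal K Δ) 1) (gradedPiece (definingIdeal K Δ) (ρ.card + 2)) := by
  intro hs
  simp only [List.nodup_cons, List.mem_cons, List.not_mem_nil, or_false, not_or,
    List.nodup_nil, and_true, not_false_eq_true] at hd
  obtain ⟨⟨hii', hij, hij'⟩, ⟨hi'j, hi'j'⟩, hjj'⟩ := hd
  simp only [List.mem_cons, List.not_mem_nil, or_false, forall_eq_or_imp, forall_eq] at hρ hΔ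
  obtain ⟨hi, hi', hj, hj'⟩ := hρ
  obtain ⟨⟨h1, h2⟩, h3, h4⟩ := hΔ
  set F := insert i (insert j ρ) with hF
  have hcard : F.card = ρ.card + 2 := by
    rw [hF, Finset.card_insert_of_notMem (by simp [hij, hi]), Finset.card_insert_of_notMem hj]
  obtain ⟨_, ⟨q, hq, rfl⟩, he⟩ := hs ⟨monomial (sqfreeExponent F) 1,
    isHomogeneous_monomial _ ((degree_sqfreeExponent F).trans hcard), rfl⟩
  have hmem : L ^ m * q - monomial (sqfreeExponent F) 1 ∈ definingIdeal K Δ :=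
    Ideal.Quotient.eq.1 (by rw [map_mul, map_pow]; exact he)
  have hcoeff : ∀ σ ∈ Δ, coeff (sqfreeExponent σ) (L ^ m * q) = if F = σ then 1 else 0 := by
    intro σ hσ
    have := mem_definingIdeal_iff.1 hmem σ hσ
    rw [coeff_sub, coeff_monomial, sub_eq_zero] at this
    rw [this]
    simp only [sqfreeExponent_injective.eq_iff]
  have hzero := derivation_derivation_pow_mul_eq_zero (c • pderiv i + c' • pderiv i')
    (d • pderiv j + d' • pderiv j') (L := L) (z := q)
    (by simp only [Derivation.add_apply, Derivation.smul_apply,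
          pderiv_eq_C_of_isHomogeneous_one hL, smul_eq_C_mul, ← C_mul, ← C_add, hcL, C_0])
    (by simp only [Derivation.add_apply, Derivation.smul_apply,
          pderiv_eq_C_of_isHomogeneous_one hL, smul_eq_C_mul, ← C_mul, ← C_add, hdL, C_0])
    (by simp only [Derivation.add_apply, Derivation.smul_apply,
          pderiv_eq_C_of_isHomogeneous_one hq, smul_eq_C_mul, ← C_mul, ← C_add, pderiv_C,
          mul_zero, add_zero]) m
  have h := congrArg (coeff (sqfreeExponent ρ)) hzero
  simp only [Derivation.add_apply, Derivation.smul_apply, map_add, Derivation.map_smul,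
    coeff_add, coeff_smul, smul_eq_mul, coeff_zero, coeff_pderiv_pderiv hij hi hj, ← hF,
    coeff_pderiv_pderiv hij' hi hj', coeff_pderiv_pderiv hi'j hi' hj,
    coeff_pderiv_pderiv hi'j' hi' hj', hcoeff _ h1, hcoeff _ h2, hcoeff _ h3, hcoeff _ h4] at h
  have n2 : F ≠ insert i (insert j' ρ) := fun e => by
    have : j ∈ insert i (insert j' ρ) := e ▸ (by simp [hF])
    simp [hj, hjj', Ne.symm hij] at this
  have n3 : F ≠ insert i' (insert j ρ) := fun e => by
    have : i ∈ insert i' (insert j ρ) := e ▸ (by simp [hF])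
    simp [hi, hii', hij] at this
  have n4 : F ≠ insert i' (insert j' ρ) := fun e => by
    have : i ∈ insert i' (insert j' ρ) := e ▸ (by simp [hF])
    simp [hi, hii', hij'] at this
  rw [if_pos trivial, if_neg n2, if_neg n3, if_neg n4] at h
  simp [hc, hd0] at h

theorem exists_ne_zero_linear_relation {K : Type*} [Field K] (a b : K) :
    ∃ c c' : K, (c ≠ 0 ∨ c' ≠ 0) ∧ c * a + c' * b = 0 := by
  by_cases ha : a = 0
  · exact ⟨1, 0, Or.inl one_ne_zero, by simp [ha]⟩
  · exact ⟨-b, a, Or.inr ha, by ring⟩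

/-- If the complex contains the join of a face with the two-point complexes on `{i, i'}` and
`{j, j'}`, then no power of a linear form maps `A_1` onto the corresponding component. -/
theorem not_surjOn_pow_of_faces {K : Type*} [Field K] {V : Type*} [DecidableEq V]
    {Δ : SimplicialCpx V} {ρ : Finset V} {i i' j j' : V} (hd : [i, i', j, j'].Nodup)
    (hρ : ∀ k ∈ [i, i', j, j'], k ∉ ρ)
    (hΔ : ∀ k ∈ [i, i'], ∀ l ∈ [j, j'], insert k (insert l ρ) ∈ Δ)
    {L : MvPolynomial V K} (hL : L.IsHomogeneous 1) (m : ℕ) :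
    ¬ Set.SurjOn (fun f => Ideal.Quotient.mk (definingIdeal K Δ) L ^ m * f)
      (gradedPiece (definingIdeal K Δ) 1) (gradedPiece (definingIdeal K Δ) (ρ.card + 2)) := by
  obtain ⟨c, c', hc, hcL⟩ := exists_ne_zero_linear_relation
    (coeff (Finsupp.single i 1) L) (coeff (Finsupp.single i' 1) L)
  obtain ⟨d, d', hd0, hdL⟩ := exists_ne_zero_linear_relation
    (coeff (Finsupp.single j 1) L) (coeff (Finsupp.single j' 1) L)
  have hcL' := (add_comm _ _).trans hcL
  have hdL' := (add_comm _ _).trans hdL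
  -- Swapping `i` with `i'` or `j` with `j'` makes both leading coefficients nonzero.
  rcases hc with hc | hc <;> rcases hd0 with hd0 | hd0
  · exact not_surjOn_pow_of_faces_aux hd hρ hΔ hL hc hd0 hcL hdL m
  · exact not_surjOn_pow_of_faces_aux (i := i) (i' := i') (j := j') (j' := j) (by grind)
      (by grind) (by grind) hL hc hd0 hcL hdL' m
  · exact not_surjOn_pow_of_faces_aux (i := i') (i' := i) (j := j) (j' := j') (by grind)
      (by grind) (by grind) hL hc hd0 hcL' hdL m
  · exact not_surjOn_pow_of_faces_aux (i := i') (i' := i) (j := j') (j' := j) (by grind)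
      (by grind) (by grind) hL hc hd0 hcL' hdL' m

/-! ### Failure of injectivity -/

/-- Only squarefree terms survive the multinomial expansion. The vanishing of the next power is
carried along for the induction. -/
theorem sum_pow_card_of_sq_eq_zero {R ι : Type*} [CommRing R] (s : Finset ι) (ℓ : ι → R)
    (h : ∀ i, ℓ i ^ 2 = 0) : (∑ i ∈ s, ℓ i) ^ s.card = s.card.factorial * ∏ i ∈ s, ℓ i ∧
      (∑ i ∈ s, ℓ i) ^ (s.card + 1) = 0 := by
  classical
  induction s using Finset.induction_on with
  | empty => simp
  | insert a s ha ih =>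
    obtain ⟨ih1, ih2⟩ := ih
    have hpow : ∀ (x : R) (k : ℕ), (ℓ a + x) ^ (k + 1) = x ^ (k + 1) + (k + 1) * x ^ k * ℓ a := by
      intro x k
      induction k with
      | zero => simp; ring
      | succ k ih =>
        rw [pow_succ, ih]
        push_cast
        linear_combination ((k : R) + 1) * x ^ k * h a
    rw [Finset.sum_insert ha, Finset.prod_insert ha, Finset.card_insert_of_notMem ha, hpow, hpow,
      ih2, ih1, pow_succ _ (s.card + 1), ih2, Nat.factorial_succ]
    constructor
    · push_cast; ring
    · simp

/-- The factor `ℓ i` kills its own summand, leaving the top power of the remaining ones. The value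
is the same for every `i`. -/
theorem sum_pow_mul_of_sq_eq_zero {R ι : Type*} [CommRing R] [Fintype ι] (ℓ : ι → R)
    (h : ∀ i, ℓ i ^ 2 = 0) (i : ι) :
    (∑ k, ℓ k) ^ (Fintype.card ι - 1) * ℓ i =
      (Fintype.card ι - 1).factorial * ∏ k, ℓ k := by
  classical
  have hcard : (Finset.univ.erase i).card = Fintype.card ι - 1 := by
    rw [Finset.card_erase_of_mem (Finset.mem_univ i), Finset.card_univ]
  have hsum := (sum_pow_card_of_sq_eq_zero (Finset.univ.erase i) ℓ h).1
  have hdvd : ∀ (x : R) (k : ℕ), (ℓ i + x) ^ k * ℓ i = x ^ k * ℓ i := by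
    intro x k
    induction k with
    | zero => simp
    | succ k ih =>
      rw [pow_succ, mul_right_comm, ih]
      linear_combination x ^ k * h i
  rw [← Finset.add_sum_erase _ _ (Finset.mem_univ i), hdvd, ← hcard, hsum,
    ← Finset.mul_prod_erase _ _ (Finset.mem_univ i)]
  ring

theorem eq_sum_of_isHomogeneous_one {K : Type*} [Field K] {V : Type*} [Fintype V]
    {L : MvPolynomial V K} (hL : L.IsHomogeneous 1) :
    L = ∑ i, C (coeff (Finsupp.single i 1) L) * X i := by
  classical
  have := hL.sum_X_mul_pderiv
  simp only [pderiv_eq_C_of_isHomogeneous_one hL, one_smul] at this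
  refine this.symm.trans ?_
  exact Finset.sum_congr rfl fun i _ => mul_comm _ _

theorem not_injOn_pow_of_X_mul_X_mem {K : Type*} [Field K] {V : Type*} [Fintype V]
    {Δ : SimplicialCpx (V ⊕ V)} (hvert : ∀ z, {z} ∈ Δ)
    (hmul : ∀ v, (X (Sum.inl v) * X (Sum.inr v) : MvPolynomial (V ⊕ V) K) ∈ definingIdeal K Δ)
    (hn : 2 ≤ Fintype.card V) {L : MvPolynomial (V ⊕ V) K} (hL : L.IsHomogeneous 1) :
    ¬ Set.InjOn (fun f => Ideal.Quotient.mk (definingIdeal K Δ) L ^ (Fintype.card V - 1) * f)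
      (gradedPiece (definingIdeal K Δ) 1) := by
  classical
  intro hinj
  let a : V ⊕ V → K := fun z => coeff (Finsupp.single z 1) L
  let p : V → MvPolynomial (V ⊕ V) K := fun v =>
    C (a (Sum.inl v)) * X (Sum.inl v) + C (a (Sum.inr v)) * X (Sum.inr v)
  have hp : ∀ v, (p v).IsHomogeneous 1 := fun v =>
    (isHomogeneous_C_mul_X _ _).add (isHomogeneous_C_mul_X _ _)
  have hsum : L = ∑ v, p v := by
    rw [eq_sum_of_isHomogeneous_one hL, Fintype.sum_sum_type, ← Finset.sum_add_distrib]
  have hsq : ∀ v, Ideal.Quotient.mk (definingIdeal K Δ) (p v) ^ 2 = 0 := fun v => by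
    rw [← map_pow, Ideal.Quotient.eq_zero_iff_mem]
    have : p v ^ 2 = C (a (Sum.inl v)) ^ 2 * X (Sum.inl v) ^ 2 +
        C (a (Sum.inr v)) ^ 2 * X (Sum.inr v) ^ 2 +
        2 * C (a (Sum.inl v)) * C (a (Sum.inr v)) * (X (Sum.inl v) * X (Sum.inr v)) := by
      simp only [p]; ring
    rw [this]
    exact add_mem (add_mem (Ideal.mul_mem_left _ _ (X_sq_mem_definingIdeal K Δ _))
      (Ideal.mul_mem_left _ _ (X_sq_mem_definingIdeal K Δ _))) (Ideal.mul_mem_left _ _ (hmul v))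
  have hcoeff : ∀ u z, coeff (Finsupp.single z 1) (p u) =
      if z = Sum.inl u ∨ z = Sum.inr u then a z else 0 := fun u z => by
    rcases z with z | z <;> rcases eq_or_ne u z with rfl | h <;>
      simp [p, coeff_C_mul, coeff_X, Finsupp.single_left_inj, *, Ne.symm]
  -- Injectivity identifies `p u` with `p v` in `A_1`; they share no variable and all vertices are
  -- faces, so the coefficients vanish.
  have hzero : ∀ u z, z = Sum.inl u ∨ z = Sum.inr u → a z = 0 := fun u z hz => by
    have : Nontrivial V := Fintype.one_lt_card_iff_nontrivial.1 hn
    obtain ⟨v, hv⟩ := exists_ne u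
    have heq : Ideal.Quotient.mk (definingIdeal K Δ) (p u) = Ideal.Quotient.mk _ (p v) := by
      refine hinj ⟨p u, hp u, rfl⟩ ⟨p v, hp v, rfl⟩ ?_
      simp only [hsum, map_sum]
      exact (sum_pow_mul_of_sq_eq_zero _ hsq u).trans (sum_pow_mul_of_sq_eq_zero _ hsq v).symm
    have := mem_definingIdeal_iff.1 (Ideal.Quotient.eq.1 heq) {z} (hvert z)
    have hz' : ¬ (z = Sum.inl v ∨ z = Sum.inr v) := by
      rcases hz with rfl | rfl <;> simp [hv.symm]
    rwa [sqfreeExponent, Finset.sum_singleton, coeff_sub, hcoeff, hcoeff, if_pos hz, if_neg hz',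
      sub_zero] at this
  have hL0 : L = 0 := by
    rw [hsum]
    refine Finset.sum_eq_zero fun v _ => ?_
    simp [p, hzero v (Sum.inl v) (Or.inl rfl), hzero v (Sum.inr v) (Or.inr rfl)]
  obtain ⟨v⟩ : Nonempty V := Fintype.card_pos_iff.1 (by omega)
  -- The exponent is positive, so `L = 0` gives the zero map, which is not injective on `A_1 ≠ 0`.
  have heq : Ideal.Quotient.mk (definingIdeal K Δ) (X (Sum.inl v)) = Ideal.Quotient.mk _ 0 := by
    refine hinj ⟨X (Sum.inl v), isHomogeneous_X _ _, rfl⟩ ⟨0, isHomogeneous_zero _ _ _, rfl⟩ ?_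
    simp [hL0, zero_pow (show Fintype.card V - 1 ≠ 0 by omega)]
  have := mem_definingIdeal_iff.1 (Ideal.Quotient.eq.1 heq) {Sum.inl v} (hvert _)
  simp [sqfreeExponent] at this

/-! ### Whiskered graphs with an independent pair of vertices -/

theorem not_hasSLP_whisker {K : Type*} [Field K] {V : Type*} [Fintype V] {G : SimpleGraph V}
    {p q : V} (hpq : p ≠ q) (hG : ¬ G.Adj p q) :
    ¬ HasSLP (definingIdeal K (facetComplex (coverIdeal K (graphComplex (whisker G))))) := by
  classical
  rintro ⟨_, ⟨L, hL, rfl⟩, h⟩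
  have hcard : 2 ≤ Fintype.card V := by
    rw [← Finset.card_pair hpq]
    exact Finset.card_le_univ _
  rcases h 1 (Fintype.card V - 1) with h | h
  · refine not_injOn_pow_of_X_mul_X_mem (fun z => ?_) (fun v => ?_) hcard hL h
    · rw [mem_facetComplex_whisker_iff]
      refine ⟨fun v hl hr => ?_, fun u v huv hu hv => ?_⟩
      · rw [Finset.mem_singleton] at hl hr
        exact Sum.inl_ne_inr (hl.trans hr.symm)
      · rw [Finset.mem_singleton] at hu hv
        exact huv.ne (Sum.inr_injective (hu.trans hv.symm))
    · have : sqfreeMonomial K {Sum.inl v, Sum.inr v} = X (Sum.inl v) * X (Sum.inr v) :=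
        Finset.prod_pair (by simp)
      rw [← this]
      refine sqfreeMonomial_mem_definingIdeal K fun hmem => ?_
      exact (mem_facetComplex_whisker_iff.1 hmem).1 v (by simp) (by simp)
  -- Here `ρ` consists of the original vertices other than `p` and `q`; as these two are
  -- nonadjacent, even adding both of their whisker vertices gives a face.
  · have hρ : (((Finset.univ.erase p).erase q).image (Sum.inl : V → V ⊕ V)).card + 2 =
        1 + (Fintype.card V - 1) := by
      rw [Finset.card_image_of_injective _ Sum.inl_injective,
        Finset.card_erase_of_mem (by simp [hpq.symm]), Finset.card_erase_of_mem (by simp),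
        Finset.card_univ]
      omega
    rw [← hρ] at h
    refine not_surjOn_pow_of_faces (i := Sum.inl p) (i' := Sum.inr p) (j := Sum.inl q)
      (j' := Sum.inr q) (by simp [hpq]) (by simp +contextual) (fun k hk l hl => ?_) hL _ h
    have hG' : ¬ G.Adj q p := fun h => hG h.symm
    rw [mem_facetComplex_whisker_iff]
    simp only [List.mem_cons, List.not_mem_nil, or_false] at hk hl
    rcases hk with rfl | rfl <;> rcases hl with rfl | rfl <;>
      refine ⟨fun v => ?_, fun u v huv => ?_⟩ <;>
      simp only [Finset.mem_insert, Finset.mem_image, Finset.mem_erase] <;> aesop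

theorem exists_ne_not_adj_of_isBipartite {V : Type*} [Fintype V] {G : SimpleGraph V}
    (hG : G.IsBipartite) (hn : 3 ≤ Fintype.card V) : ∃ p q, p ≠ q ∧ ¬ G.Adj p q := by
  obtain ⟨c⟩ := hG
  -- Pigeonhole: among three vertices two share a colour.
  obtain ⟨p, q, hpq, h⟩ := Fintype.exists_ne_map_eq_of_card_lt c (by rwa [Fintype.card_fin])
  exact ⟨p, q, hpq, fun hadj => c.valid hadj h⟩

end Lefschetz

theorem mainTheorem4 (K : Type*) [Field K] [CharZero K] {V : Type*} [Fintype V]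
    (G : SimpleGraph V) (hG : G.IsBipartite) (hn : 5 ≤ Fintype.card V)
    (Δ : SimplicialCpx (V ⊕ V))
    (hΔ : Δ = facetComplex (coverIdeal K (graphComplex (whisker G)))) :
    IsLevelMonomialAlgebra (definingIdeal K Δ) ∧ ¬ HasSLP (definingIdeal K Δ) := by
  subst hΔ
  obtain ⟨p, q, hpq, hadj⟩ := exists_ne_not_adj_of_isBipartite hG (by omega)
  exact ⟨isLevelMonomialAlgebra_whisker K G, not_hasSLP_whisker hpq hadj⟩
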